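/- **Theorem (the rewrite system is confluent and strongly normalizing).** Consider the following many-sorted first-order signature. The sorts are $\mathsf B$ (booleans), $\mathsf N$ (naturals), $\mathsf L_S$ (sublevels), $\mathrm{Set}\,T$ for $T\in\{\mathsf N,\mathsf L_S\}$, and $\mathsf L$ (levels). The symbols are * $\mathsf{true},\mathsf{false}:\mathsf B$; $\mathsf{and},\mathsf{or}:\mathsf B\to\mathsf B\to\mathsf B$; $\mathsf{not}:\mathsf B\to\mathsf B$; and, for every sort $s$, $\mathsf{ite}_s:\mathsf B\to s\to s\to s$; * $0:\mathsf N$; $\mathsf s:\mathsf N\to\mathsf N$; $+,\max_{\mathsf N}:\mathsf N\to\mathsf N\to\mathsf N$; $\le_{\mathsf N},=_{\mathsf N},<_{\mathsf N}:\mathsf N\to\mathsf N\to\mathsf B$; * for $T\in\{\mathsf N,\mathsf L_S\}$: $\mathrm{nil}_T:\mathrm{Set}\,T$; $::_T\,:T\to\mathrm{Set}\,T\to\mathrm{Set}\,T$; $\oplus_T,\ominus_T:\mathrm{Set}\,T\to T\to\mathrm{Set}\,T$ (insertion, removal); $\cup_T:\mathrm{Set}\,T\to\mathrm{Set}\,T\to\mathrm{Set}\,T$;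 $\in_T\,:T\to\mathrm{Set}\,T\to\mathsf B$; $\subseteq_T,=_{\mathrm{Set}\,T},\preceq_{\mathrm{Set}\,T},\prec_{\mathrm{Set}\,T}:\mathrm{Set}\,T\to\mathrm{Set}\,T\to\mathsf B$; * $\mathsf A:\mathrm{Set}\,\mathsf N\to\mathsf N\to\mathsf N\to\mathsf L_S$; $\mathsf B_s:\mathrm{Set}\,\mathsf N\to\mathsf N\to\mathsf L_S$; $\preceq_S,\prec_S,\le_S:\mathsf L_S\to\mathsf L_S\to\mathsf B$; * $0_L:\mathsf L$; $s_L:\mathsf L\to\mathsf L$; $\max_L,\mathrm{imax}_L:\mathsf L\to\mathsf L\to\mathsf L$; $\mathrm{var}:\mathsf N\to\mathsf L$; $\mathrm{max}_S:\mathrm{Set}\,\mathsf L_S\to\mathsf L$; $\mathrm{succ}_S:\mathrm{Set}\,\mathsf L_S\to\mathrm{Set}\,\mathsf L_S$; $\mathrm{maxaux}:\mathrm{Set}\,\mathsf L_S\to\mathsf L_S\to\mathrm{Set}\,\mathsf L_S$; $\mathrm{imax}_S:\mathsf L_S\to\mathsf L_S\to\mathsf L$; $\mathrm{imaxaux}:\mathsf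 L_S\to\mathsf L\to\mathsf L$; $\mathrm{eval}_S:\mathsf L_S\to\mathsf N\to\mathsf N\to\mathsf L$; $\mathrm{eval}_L:\mathsf L\to\mathsf N\to\mathsf N\to\mathsf L$. Write $\preceq_{\mathsf N}$ for $\le_{\mathsf N}$, $\preceq_{\mathsf L_S}$ for $\preceq_S$, $x\equiv_T y$ for $\mathsf{and}(x\preceq_T y,\;y\preceq_T x)$, and $\{x\}$ for $\mathrm{nil}_T\oplus_T x$; indices are omitted where clear. The rewrite rules are the following (all other letters are variables). *Booleans and if-then-else (every sort):* $\mathsf{and}(\mathsf{true},b)\to b$; $\mathsf{and}(\mathsf{false},b)\to\mathsf{false}$; $\mathsf{or}(\mathsf{true},b)\to\mathsf{true}$; $\mathsf{or}(\mathsf{false},b)\to b$; $\mathsf{not}(\mathsf{true})\to\mathsf{false}$; $\mathsf{not}(\mathsf{false})\to\mathsf{true}$; $\mathsf{ite}(\mathsf{true},a,b)\to a$; $\mathsf{ite}(\mathsf{false},a,b)\to b$. *Naturals:* $0+y\to y$; $\mathsf s x+y\to\mathsf s(x+y)$; $0\le y\to\mathsf{true}$; $\mathsf s x\le 0\to\mathsf{false}$;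 $\mathsf s x\le\mathsf s y\to x\le y$; $(0=0)\to\mathsf{true}$; $(0=\mathsf s y)\to\mathsf{false}$; $(\mathsf s x=0)\to\mathsf{false}$; $(\mathsf s x=\mathsf s y)\to(x=y)$; $x<0\to\mathsf{false}$; $0<\mathsf s y\to\mathsf{true}$; $\mathsf s x<\mathsf s y\to x<y$; $\max_{\mathsf N}(0,y)\to y$; $\max_{\mathsf N}(\mathsf s x,0)\to\mathsf s x$; $\max_{\mathsf N}(\mathsf s x,\mathsf s y)\to\mathsf s(\max_{\mathsf N}(x,y))$. *Sets over $T$ (sorted lists without repetition), for both $T$:* $\mathrm{nil}\oplus x\to x::\mathrm{nil}$; $(y::E)\oplus x\to\mathsf{ite}(x\preceq y,\ \mathsf{ite}(y\preceq x,\ y::E,\ x::(y::E)),\ y::(E\oplus x))$; $\mathrm{nil}\ominus x\to\mathrm{nil}$; $(y::E)\ominus x\to\mathsf{ite}(x\equiv y,\ E,\ y::(E\ominus x))$; $E\cup\mathrm{nil}\to E$; $E\cup(y::F)\to(E\oplus y)\cup F$; $x\in\mathrm{nil}\to\mathsf{false}$; $x\in(y::E)\to\mathsf{or}(x\equiv y,\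 x\in E)$; $\mathrm{nil}\subseteq F\to\mathsf{true}$; $(x::E)\subseteq F\to\mathsf{and}(x\in F,\ E\subseteq F)$; $(\mathrm{nil}=\mathrm{nil})\to\mathsf{true}$; $(\mathrm{nil}=y::F)\to\mathsf{false}$; $(x::E=\mathrm{nil})\to\mathsf{false}$; $(x::E=y::F)\to\mathsf{and}(x\equiv y,\ E=F)$; $\mathrm{nil}\preceq F\to\mathsf{true}$; $x::E\preceq\mathrm{nil}\to\mathsf{false}$; $x::E\preceq y::F\to\mathsf{and}(x\preceq y,\ \mathsf{or}(\mathsf{not}(y\preceq x),\ E\preceq F))$; $E\prec F\to\mathsf{and}(E\preceq F,\ \mathsf{not}(F\preceq E))$. *Total order on sublevels:* $\mathsf A(E,x,S)\preceq_S\mathsf B_s(F,K)\to\mathsf{true}$; $\mathsf B_s(F,K)\preceq_S\mathsf A(E,x,S)\to\mathsf{false}$; $\mathsf A(E,x,S)\preceq_S\mathsf A(F,y,K)\to\mathsf{or}(E\prec F,\ \mathsf{and}(E=F,\ \mathsf{or}(x<y,\ \mathsf{and}(x=y,\ S\le K))))$; $\mathsf B_s(E,S)\preceq_S\mathsf B_s(F,K)\to\mathsf{or}(E\prec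 F,\ \mathsf{and}(E=F,\ S\le K))$; $u\prec_S w\to\mathsf{and}(u\preceq_S w,\ \mathsf{not}(w\preceq_S u))$. *Comparison of sublevels:* $\mathsf A(E,x,S)\le_S\mathsf B_s(F,K)\to\mathsf{false}$; $\mathsf B_s(E,S)\le_S\mathsf B_s(F,K)\to\mathsf{and}(F\subseteq E,\ S\le K)$; $\mathsf B_s(E,\mathsf s S)\le_S\mathsf A(F,y,K)\to\mathsf{and}(F\subseteq E,\ S\le K)$; $\mathsf A(E,x,S)\le_S\mathsf A(F,y,K)\to\mathsf{and}(F\subseteq E,\ \mathsf{and}(x=y,\ S\le K))$. *Zero, variables, successor:* $0_L\to\max_S(\mathrm{nil})$; $\mathrm{var}(x)\to\max_S\{\mathsf A(\{x\},x,0)\}$; $\mathrm{succ}_S(\mathrm{nil})\to\mathrm{nil}$; $\mathrm{succ}_S(\mathsf B_s(E,S)::q)\to\mathrm{succ}_S(q)\oplus\mathsf B_s(E,\mathsf s S)$; $\mathrm{succ}_S(\mathsf A(E,x,S)::q)\to\mathrm{succ}_S(q)\oplus\mathsf A(E,x,\mathsf s S)$; $s_L(\max_S(\mathrm{nil}))\to\max_S\{\mathsf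 B_s(\mathrm{nil},\mathsf s 0)\}$; $s_L(\max_S(u::q))\to\max_S(\mathrm{succ}_S(u::q))$. *Maximum:* $\mathrm{maxaux}(\mathrm{nil},u)\to\{u\}$; $\mathrm{maxaux}(u::E,w)\to\mathsf{ite}(w\le_S u,\ E\oplus u,\ \mathsf{ite}(u\le_S w,\ E\oplus w,\ \mathrm{maxaux}(E,w)\oplus u))$; $\max_L(\max_S E,\max_S\mathrm{nil})\to\max_S E$; $\max_L(\max_S E,\max_S(u::F))\to\max_L(\max_S(\mathrm{maxaux}(E,u)),\max_S F)$. *Impredicative maximum:* $\mathrm{imax}_S(\mathsf A(E,x,S),\mathsf B_s(F,K))\to\max_L(\max_S\{\mathsf A(E\cup F,x,S)\},\max_S\{\mathsf B_s(F,K)\})$; $\mathrm{imax}_S(\mathsf B_s(E,S),\mathsf B_s(F,K))\to\max_L(\max_S\{\mathsf B_s(E\cup F,S)\},\max_S\{\mathsf B_s(F,K)\})$; $\mathrm{imax}_S(\mathsf B_s(E,S),\mathsf A(F,x,K))\to\max_L(\max_S\{\mathsf B_s(E\cup F,S)\},\max_S\{\mathsf A(F,x,K)\})$; $\mathrm{imax}_S(\mathsf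 A(E,x,S),\mathsf A(F,y,K))\to\max_L(\max_S\{\mathsf A(E\cup F,x,S)\},\max_S\{\mathsf A(F,y,K)\})$; $\mathrm{imax}_L(\max_S\mathrm{nil},t)\to t$; $\mathrm{imax}_L(\max_S(u::q),t)\to\max_L(\mathrm{imaxaux}(u,t),\mathrm{imax}_L(\max_S q,t))$; $\mathrm{imaxaux}(u,\max_S\mathrm{nil})\to\max_S\mathrm{nil}$; $\mathrm{imaxaux}(u,\max_S(w::q))\to\max_L(\mathrm{imax}_S(u,w),\mathrm{imaxaux}(u,\max_S q))$. *Substitution:* $\mathrm{eval}_S(\mathsf B_s(E,S),y,n)\to\mathsf{ite}(\mathsf{and}(y\in E,n=0),\ \max_S\mathrm{nil},\ \max_S\{\mathsf B_s(E\ominus y,S)\})$; $\mathrm{eval}_S(\mathsf A(E,x,S),y,n)\to\mathsf{ite}(\mathsf{and}(y\in E,n=0),\ \max_S\mathrm{nil},\ \mathsf{ite}(x=y,\ \max_S\{\mathsf B_s(\mathrm{nil},S+n)\},\ \max_S\{\mathsf A(E\ominus y,x,S)\}))$; $\mathrm{eval}_L(\max_S\mathrm{nil},y,n)\to\max_S\mathrm{nil}$;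 $\mathrm{eval}_L(\max_S(u::q),y,n)\to\max_L(\mathrm{eval}_S(u,y,n),\mathrm{eval}_L(\max_S q,y,n))$. Let $\hookrightarrow$ be the one-step rewrite relation generated by these rules (closure under substitutions and contexts) on first-order terms with countably many variables of each sort. Then $\hookrightarrow$ is confluent (if $b\mathrel{{}^*\!\!\hookleftarrow}a\hookrightarrow^* c$ then $b\hookrightarrow^* d\mathrel{{}^*\!\!\hookleftarrow}c$ for some $d$) and strongly normalizing (there is no infinite sequence $t_0\hookrightarrow t_1\hookrightarrow\cdots$). This holds on the well-sorted terms, and also on all terms in which every symbol has the right number of arguments, well sorted or not. -/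

import Mathlib

namespace LevelRewriting

/-! ### First-order signature -/

/-- The two types `T` with a total order over which sets `Set T` are formed:
natural numbers and sublevels. -/
inductive Elt
  | nat
  | sub
  deriving DecidableEq

/-- The types (sorts) of the system: booleans, the ordered types (naturals and sublevels),
sets over an ordered type, and levels. -/
inductive Srt
  | bool
  | elt (T : Elt)
  | set (T : Elt)
  | level
  deriving DecidableEq

namespace Srt

/-- The type of natural numbers. -/
abbrev nat : Srt := elt Elt.nat

/-- The type of sublevels. -/
abbrev sub : Srt := elt Elt.sub

end Srt

/-- The function symbols. -/
inductive Sym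
  -- booleans
  | tt | ff | and | or | not
  -- natural numbers
  | zero | succ | plus | leN | eqN | ltN | maxN
  -- if-then-else at every type
  | ite (s : Srt)
  -- sets, implemented as sorted lists
  | nil (T : Elt) | cons (T : Elt)
  | add (T : Elt) | del (T : Elt) | union (T : Elt)
  | mem (T : Elt) | subset (T : Elt) | eqSet (T : Elt)
  | leSet (T : Elt) | ltSet (T : Elt)
  -- sublevels, their total order (strict and non-strict), and their comparison
  | A | B | ordS | sordS | leS
  -- levels
  | zeroL | succL | maxL | imaxL | varL
  -- the embedding of sets of sublevels into levels
  | maxS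
  -- auxiliary functions for the successor, the maximum and the impredicative maximum
  | succS | maxAux | imaxS | imaxAux
  -- substitution of a variable by a natural number in sublevels and in levels
  | evalS | evalL
  deriving DecidableEq

/-- The types of the arguments of a symbol. -/
def Sym.dom : Sym → List Srt
  | .tt => []
  | .ff => []
  | .and => [.bool, .bool]
  | .or => [.bool, .bool]
  | .not => [.bool]
  | .zero => []
  | .succ => [.nat]
  | .plus => [.nat, .nat]
  | .leN => [.nat, .nat]
  | .eqN => [.nat, .nat]
  | .ltN => [.nat, .nat]
  | .maxN => [.nat, .nat]
  | .ite s => [.bool, s, s]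
  | .nil _ => []
  | .cons T => [.elt T, .set T]
  | .add T => [.set T, .elt T]
  | .del T => [.set T, .elt T]
  | .union T => [.set T, .set T]
  | .mem T => [.elt T, .set T]
  | .subset T => [.set T, .set T]
  | .eqSet T => [.set T, .set T]
  | .leSet T => [.set T, .set T]
  | .ltSet T => [.set T, .set T]
  | .A => [.set .nat, .nat, .nat]
  | .B => [.set .nat, .nat]
  | .ordS => [.sub, .sub]
  | .sordS => [.sub, .sub]
  | .leS => [.sub, .sub]
  | .zeroL => []
  | .succL => [.level]
  | .maxL => [.level, .level]
  | .imaxL => [.level, .level]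
  | .varL => [.nat]
  | .maxS => [.set .sub]
  | .succS => [.set .sub]
  | .maxAux => [.set .sub, .sub]
  | .imaxS => [.sub, .sub]
  | .imaxAux => [.sub, .level]
  | .evalS => [.sub, .nat, .nat]
  | .evalL => [.level, .nat, .nat]

/-- The type of the result of a symbol. -/
def Sym.cod : Sym → Srt
  | .tt => .bool
  | .ff => .bool
  | .and => .bool
  | .or => .bool
  | .not => .bool
  | .zero => .nat
  | .succ => .nat
  | .plus => .nat
  | .leN => .bool
  | .eqN => .bool
  | .ltN => .bool
  | .maxN => .nat
  | .ite s => s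
  | .nil T => .set T
  | .cons T => .set T
  | .add T => .set T
  | .del T => .set T
  | .union T => .set T
  | .mem _ => .bool
  | .subset _ => .bool
  | .eqSet _ => .bool
  | .leSet _ => .bool
  | .ltSet _ => .bool
  | .A => .sub
  | .B => .sub
  | .ordS => .bool
  | .sordS => .bool
  | .leS => .bool
  | .zeroL => .level
  | .succL => .level
  | .maxL => .level
  | .imaxL => .level
  | .varL => .level
  | .maxS => .level
  | .succS => .set .sub
  | .maxAux => .set .sub
  | .imaxS => .level
  | .imaxAux => .level
  | .evalS => .level
  | .evalL => .level

/-! ### Terms, substitutions and rewriting -/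

/-- Variables: countably many for each type. -/
structure Var where
  sort : Srt
  idx : ℕ
  deriving DecidableEq

/-- First-order terms over the signature. Only the number of arguments is enforced here;
see `Term.WellTyped` for the typing discipline. -/
inductive Term
  | var (x : Var)
  | app (f : Sym) (ts : Fin f.dom.length → Term)

/-- The type of a term, read off from its head. -/
def Term.sort : Term → Srt
  | .var x => x.sort
  | .app f _ => f.cod

/-- A term is well typed if all arguments of all symbols in it have the declared types. -/
def Term.WellTyped : Term → Prop
  | .var _ => True
  | .app f ts => ∀ i, (ts i).WellTyped ∧ (ts i).sort = f.dom.get i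

/-- Application of a substitution to a term. -/
def Term.subst (σ : Var → Term) : Term → Term
  | .var x => σ x
  | .app f ts => .app f fun i => (ts i).subst σ

/-- A rewrite rule `lhs ⟶ rhs`. -/
structure Rule where
  lhs : Term
  rhs : Term

/-- One-step rewriting with the rules `R`: replacement, at any position of a term, of an
instance of the left-hand side of a rule by the same instance of its right-hand side. -/
inductive Step (R : List Rule) : Term → Term → Prop
  | root (ρ : Rule) (hρ : ρ ∈ R) (σ : Var → Term) : Step R (ρ.lhs.subst σ) (ρ.rhs.subst σ)
  | arg (f : Sym) (ts : Fin f.dom.length → Term) (i : Fin f.dom.length) (u : Term)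
      (h : Step R (ts i) u) : Step R (.app f ts) (.app f (Function.update ts i u))

/-- One-step rewriting between well-typed terms. -/
def TypedStep (R : List Rule) (t u : {t : Term // t.WellTyped}) : Prop :=
  Step R t.1 u.1

/-- Any two reduction sequences from the same object can be joined. -/
def Confluent {α : Type*} (r : α → α → Prop) : Prop :=
  ∀ a b c, Relation.ReflTransGen r a b → Relation.ReflTransGen r a c →
    ∃ d, Relation.ReflTransGen r b d ∧ Relation.ReflTransGen r c d

/-- There is no infinite reduction sequence. -/
def StronglyNormalizing {α : Type*} (r : α → α → Prop) : Prop :=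
  ¬ ∃ s : ℕ → α, ∀ n, r (s n) (s (n + 1))

/-! ### Abbreviations for terms -/

namespace Term

abbrev tt : Term := app .tt ![]
abbrev ff : Term := app .ff ![]
abbrev and (a b : Term) : Term := app .and ![a, b]
abbrev or (a b : Term) : Term := app .or ![a, b]
abbrev not (a : Term) : Term := app .not ![a]
abbrev zero : Term := app .zero ![]
abbrev succ (x : Term) : Term := app .succ ![x]
abbrev plus (x y : Term) : Term := app .plus ![x, y]
abbrev leN (x y : Term) : Term := app .leN ![x, y]
abbrev eqN (x y : Term) : Term := app .eqN ![x, y]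
abbrev ltN (x y : Term) : Term := app .ltN ![x, y]
abbrev maxN (x y : Term) : Term := app .maxN ![x, y]
abbrev ite (s : Srt) (c u v : Term) : Term := app (.ite s) ![c, u, v]
abbrev nil (T : Elt) : Term := app (.nil T) ![]
abbrev cons (T : Elt) (x E : Term) : Term := app (.cons T) ![x, E]
abbrev add (T : Elt) (E x : Term) : Term := app (.add T) ![E, x]
abbrev del (T : Elt) (E x : Term) : Term := app (.del T) ![E, x]
abbrev union (T : Elt) (E F : Term) : Term := app (.union T) ![E, F]
abbrev mem (T : Elt) (x E : Term) : Term := app (.mem T) ![x, E]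
abbrev subset (T : Elt) (E F : Term) : Term := app (.subset T) ![E, F]
abbrev eqSet (T : Elt) (E F : Term) : Term := app (.eqSet T) ![E, F]
abbrev leSet (T : Elt) (E F : Term) : Term := app (.leSet T) ![E, F]
abbrev ltSet (T : Elt) (E F : Term) : Term := app (.ltSet T) ![E, F]
/-- The singleton `{x}`, that is, the empty set to which `x` is added. -/
abbrev single (T : Elt) (x : Term) : Term := add T (nil T) x
abbrev A (E x S : Term) : Term := app .A ![E, x, S]
abbrev B (E S : Term) : Term := app .B ![E, S]
abbrev ordS (u v : Term) : Term := app .ordS ![u, v]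
abbrev sordS (u v : Term) : Term := app .sordS ![u, v]
abbrev leS (u v : Term) : Term := app .leS ![u, v]
abbrev zeroL : Term := app .zeroL ![]
abbrev succL (t : Term) : Term := app .succL ![t]
abbrev maxL (t u : Term) : Term := app .maxL ![t, u]
abbrev imaxL (t u : Term) : Term := app .imaxL ![t, u]
abbrev varL (x : Term) : Term := app .varL ![x]
abbrev maxS (E : Term) : Term := app .maxS ![E]
abbrev succS (E : Term) : Term := app .succS ![E]
abbrev maxAux (E u : Term) : Term := app .maxAux ![E, u]
abbrev imaxS (u v : Term) : Term := app .imaxS ![u, v]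
abbrev imaxAux (u t : Term) : Term := app .imaxAux ![u, t]
abbrev evalS (u y n : Term) : Term := app .evalS ![u, y, n]
abbrev evalL (t y n : Term) : Term := app .evalL ![t, y, n]

/-- The total order on the elements of `T`, with which `Set T` is sorted. -/
def leElt : Elt → Term → Term → Term
  | .nat => leN
  | .sub => ordS

/-- Equality of two elements of `T`, expressed by the total order. -/
abbrev eqElt (T : Elt) (x y : Term) : Term := and (leElt T x y) (leElt T y x)

/-- The variable number `i` of type `s`. -/
abbrev v (s : Srt) (i : ℕ) : Term := var ⟨s, i⟩

end Term

open Term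

/-! ### The rewrite rules -/

/-- Booleans. -/
def boolRules : List Rule :=
  let b := v .bool 0
  [ ⟨and tt b, b⟩,
    ⟨and ff b, ff⟩,
    ⟨or tt b, tt⟩,
    ⟨or ff b, b⟩,
    ⟨not tt, ff⟩,
    ⟨not ff, tt⟩ ]

/-- Natural numbers. -/
def natRules : List Rule :=
  let x := v .nat 0
  let y := v .nat 1
  [ ⟨plus zero y, y⟩,
    ⟨plus (succ x) y, succ (plus x y)⟩,
    ⟨leN zero y, tt⟩,
    ⟨leN (succ x) zero, ff⟩,
    ⟨leN (succ x) (succ y), leN x y⟩,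
    ⟨eqN zero zero, tt⟩,
    ⟨eqN zero (succ y), ff⟩,
    ⟨eqN (succ x) zero, ff⟩,
    ⟨eqN (succ x) (succ y), eqN x y⟩,
    ⟨ltN x zero, ff⟩,
    ⟨ltN zero (succ y), tt⟩,
    ⟨ltN (succ x) (succ y), ltN x y⟩,
    ⟨maxN zero y, y⟩,
    ⟨maxN (succ x) zero, succ x⟩,
    ⟨maxN (succ x) (succ y), succ (maxN x y)⟩ ]

/-- If-then-else at type `s`. -/
def iteRules (s : Srt) : List Rule :=
  let a := v s 0
  let b := v s 1
  [ ⟨ite s tt a b, a⟩,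
    ⟨ite s ff a b, b⟩ ]

/-- Finite sets over `T`, implemented as lists that are sorted increasingly and without
repetition: insertion and removal of an element, union, membership, inclusion, equality, and
the lexicographic total order with its strict version. -/
def setRules (T : Elt) : List Rule :=
  let x := v (.elt T) 0
  let y := v (.elt T) 1
  let E := v (.set T) 0
  let F := v (.set T) 1
  [ ⟨add T (nil T) x, cons T x (nil T)⟩,
    ⟨add T (cons T y E) x,
      ite (.set T) (leElt T x y)
        (ite (.set T) (leElt T y x) (cons T y E) (cons T x (cons T y E)))
        (cons T y (add T E x))⟩,
    ⟨del T (nil T) x, nil T⟩,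
    ⟨del T (cons T y E) x, ite (.set T) (eqElt T x y) E (cons T y (del T E x))⟩,
    ⟨union T E (nil T), E⟩,
    ⟨union T E (cons T y F), union T (add T E y) F⟩,
    ⟨mem T x (nil T), ff⟩,
    ⟨mem T x (cons T y E), or (eqElt T x y) (mem T x E)⟩,
    ⟨subset T (nil T) F, tt⟩,
    ⟨subset T (cons T x E) F, and (mem T x F) (subset T E F)⟩,
    ⟨eqSet T (nil T) (nil T), tt⟩,
    ⟨eqSet T (nil T) (cons T y F), ff⟩,
    ⟨eqSet T (cons T x E) (nil T), ff⟩,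
    ⟨eqSet T (cons T x E) (cons T y F), and (eqElt T x y) (eqSet T E F)⟩,
    ⟨leSet T (nil T) F, tt⟩,
    ⟨leSet T (cons T x E) (nil T), ff⟩,
    ⟨leSet T (cons T x E) (cons T y F),
      and (leElt T x y) (or (not (leElt T y x)) (leSet T E F))⟩,
    ⟨ltSet T E F, and (leSet T E F) (not (leSet T F E))⟩ ]

/-- Sublevels: the total order `ordS` (all `A` before all `B`, lexicographic inside each
class), its strict version `sordS`, and the comparison `leS` that reflects the semantic
inequality of sublevels. -/
def sublevelRules : List Rule :=
  let E := v (.set .nat) 0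
  let F := v (.set .nat) 1
  let x := v .nat 0
  let y := v .nat 1
  let S := v .nat 2
  let K := v .nat 3
  let u := v .sub 0
  let w := v .sub 1
  [ ⟨ordS (A E x S) (B F K), tt⟩,
    ⟨ordS (B F K) (A E x S), ff⟩,
    ⟨ordS (A E x S) (A F y K),
      or (ltSet .nat E F)
        (and (eqSet .nat E F) (or (ltN x y) (and (eqN x y) (leN S K))))⟩,
    ⟨ordS (B E S) (B F K), or (ltSet .nat E F) (and (eqSet .nat E F) (leN S K))⟩,
    ⟨sordS u w, and (ordS u w) (not (ordS w u))⟩,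
    ⟨leS (A E x S) (B F K), ff⟩,
    ⟨leS (B E S) (B F K), and (subset .nat F E) (leN S K)⟩,
    ⟨leS (B E (succ S)) (A F y K), and (subset .nat F E) (leN S K)⟩,
    ⟨leS (A E x S) (A F y K), and (subset .nat F E) (and (eqN x y) (leN S K))⟩ ]

/-- Zero, variables and successor. -/
def succRules : List Rule :=
  let E := v (.set .nat) 0
  let x := v .nat 0
  let S := v .nat 2
  let u := v .sub 0
  let q := v (.set .sub) 0
  [ ⟨zeroL, maxS (nil .sub)⟩,
    ⟨varL x, maxS (single .sub (A (single .nat x) x zero))⟩,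
    ⟨succS (nil .sub), nil .sub⟩,
    ⟨succS (cons .sub (B E S) q), add .sub (succS q) (B E (succ S))⟩,
    ⟨succS (cons .sub (A E x S) q), add .sub (succS q) (A E x (succ S))⟩,
    ⟨succL (maxS (nil .sub)), maxS (single .sub (B (nil .nat) (succ zero)))⟩,
    ⟨succL (maxS (cons .sub u q)), maxS (succS (cons .sub u q))⟩ ]

/-- Maximum. -/
def maxRules : List Rule :=
  let u := v .sub 0
  let w := v .sub 1
  let E := v (.set .sub) 0
  let F := v (.set .sub) 1
  [ ⟨maxAux (nil .sub) u, single .sub u⟩,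
    ⟨maxAux (cons .sub u E) w,
      ite (.set .sub) (leS w u) (add .sub E u)
        (ite (.set .sub) (leS u w) (add .sub E w) (add .sub (maxAux E w) u))⟩,
    ⟨maxL (maxS E) (maxS (nil .sub)), maxS E⟩,
    ⟨maxL (maxS E) (maxS (cons .sub u F)), maxL (maxS (maxAux E u)) (maxS F)⟩ ]

/-- Impredicative maximum. -/
def imaxRules : List Rule :=
  let E := v (.set .nat) 0
  let F := v (.set .nat) 1
  let x := v .nat 0
  let y := v .nat 1
  let S := v .nat 2
  let K := v .nat 3
  let u := v .sub 0
  let w := v .sub 1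
  let q := v (.set .sub) 0
  let t := v .level 0
  [ ⟨imaxS (A E x S) (B F K),
      maxL (maxS (single .sub (A (union .nat E F) x S))) (maxS (single .sub (B F K)))⟩,
    ⟨imaxS (B E S) (B F K),
      maxL (maxS (single .sub (B (union .nat E F) S))) (maxS (single .sub (B F K)))⟩,
    ⟨imaxS (B E S) (A F x K),
      maxL (maxS (single .sub (B (union .nat E F) S))) (maxS (single .sub (A F x K)))⟩,
    ⟨imaxS (A E x S) (A F y K),
      maxL (maxS (single .sub (A (union .nat E F) x S))) (maxS (single .sub (A F y K)))⟩,
    ⟨imaxL (maxS (nil .sub)) t, t⟩,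
    ⟨imaxL (maxS (cons .sub u q)) t, maxL (imaxAux u t) (imaxL (maxS q) t)⟩,
    ⟨imaxAux u (maxS (nil .sub)), maxS (nil .sub)⟩,
    ⟨imaxAux u (maxS (cons .sub w q)), maxL (imaxS u w) (imaxAux u (maxS q))⟩ ]

/-- Substitution of the variable number `y` by the natural number `n`. -/
def substRules : List Rule :=
  let E := v (.set .nat) 0
  let x := v .nat 0
  let y := v .nat 1
  let S := v .nat 2
  let n := v .nat 3
  let u := v .sub 0
  let q := v (.set .sub) 0
  [ ⟨evalS (B E S) y n,
      ite .level (and (mem .nat y E) (eqN n zero)) (maxS (nil .sub))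
        (maxS (single .sub (B (del .nat E y) S)))⟩,
    ⟨evalS (A E x S) y n,
      ite .level (and (mem .nat y E) (eqN n zero)) (maxS (nil .sub))
        (ite .level (eqN x y) (maxS (single .sub (B (nil .nat) (plus S n))))
          (maxS (single .sub (A (del .nat E y) x S))))⟩,
    ⟨evalL (maxS (nil .sub)) y n, maxS (nil .sub)⟩,
    ⟨evalL (maxS (cons .sub u q)) y n, maxL (evalS u y n) (evalL (maxS q) y n)⟩ ]

/-- The whole rewrite system. -/
def rules : List Rule :=
  boolRules ++ natRules ++
    iteRules .bool ++ iteRules .nat ++ iteRules .sub ++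
    iteRules (.set .nat) ++ iteRules (.set .sub) ++ iteRules .level ++
    setRules .nat ++ setRules .sub ++
    sublevelRules ++ succRules ++ maxRules ++ imaxRules ++ substRules

end LevelRewriting

/-!
The rewrite system is an orthogonal constructor system whose symbols call each other
hierarchically, and this is checked rule by rule by evaluating decidable conditions.

*Termination.* Each symbol `f` gets a rank, and a recursion argument. In every rule with head
`f`, the right-hand side is built from variables of the left-hand side, symbols of rank less
than that of `f`, and recursive calls of `f` in which the recursion argument has become a proper
subterm of the corresponding pattern (after removal of an outer `maxS`: the recursive calls on
levels go from `maxS (cons u q)` to `maxS q`). This is independent of the typing discipline.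
An application `f ts` with accessible arguments `ts` is then accessible
(`SN.app`), by induction on the rank of `f`, on the recursion argument, ordered by the
transitive closure of "one-step reduct or immediate subterm", which is well founded on
accessible terms (`SN.acc_below`), and finally on all the arguments, ordered by reduction
(`acc_update`).

*Confluence.* By Newman's lemma (`Confluent.of_locally`) local confluence is enough. Two
left-hand sides never have a common instance, and their arguments are linear and consist of
constructors and variables. So a second redex inside a redex lies in the part matched by some
variable `x` (`Step.of_pattern`), and both reductions are joined by reducing inside all copies
of that part (`Step.join_root_arg`).

*Typed terms.* Reduction preserves well-typedness and types (`Step.wellTyped`), so both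
properties restrict to well-typed terms.
-/

namespace LevelRewriting

open Relation Function

/-! ### Accessibility and Newman's lemma -/

theorem acc_update_apply {α ι : Type*} [DecidableEq ι] {r : α → α → Prop} {a : ι → α}
    (ha : ∀ i, Acc r (a i)) {i : ι} {u : α} (hu : r u (a i)) (j : ι) :
    Acc r (update a i u j) := by
  rcases eq_or_ne j i with rfl | hj
  · simpa using (ha j).inv hu
  · simpa [hj] using ha j

/-- If every entry of a finite tuple is accessible for `r`, then the tuple is accessible for the
relation that decreases one entry. -/
theorem acc_update {α ι : Type*} [Fintype ι] [DecidableEq ι] {r : α → α → Prop} {a : ι → α}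
    (ha : ∀ i, Acc r (a i)) :
    Acc (fun b a : ι → α => ∃ i u, r u (a i) ∧ b = update a i u) a := by
  -- Only the positions in a finite set `s` may decrease; `s` is then enlarged to everything.
  suffices h : ∀ s : Finset ι, ∀ a : ι → α, (∀ i, Acc r (a i)) →
      Acc (fun b a : ι → α => ∃ i ∈ s, ∃ u, r u (a i) ∧ b = update a i u) a by
    simpa using h Finset.univ a ha
  intro s
  induction s using Finset.induction_on with
  | empty => exact fun a _ => ⟨_, by simp⟩
  | insert k s _ ihs =>
    suffices h : ∀ x, Acc r x → ∀ a : ι → α, (∀ i, Acc r (a i)) → a k = x →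
        Acc (fun b a : ι → α => ∃ i ∈ insert k s, ∃ u, r u (a i) ∧ b = update a i u) a from
      fun a ha => h _ (ha k) a ha rfl
    intro x hx
    induction hx with
    | intro x _ ihx =>
      intro a ha hak
      have hs := ihs a ha
      induction hs with
      | intro a _ iha =>
        refine ⟨_, ?_⟩
        rintro _ ⟨i, hi, u, hu, rfl⟩
        rcases eq_or_ne i k with rfl | hik
        · exact ihx u (hak ▸ hu) _ (acc_update_apply ha hu) (by simp)
        · have his : i ∈ s := by simpa [hik] using hi
          exact iha _ ⟨i, his, u, hu, rfl⟩ (acc_update_apply ha hu) (by simpa [hik.symm] using hak)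

theorem stronglyNormalizing_of_acc {α : Type*} {r : α → α → Prop}
    (h : ∀ a, Acc (swap r) a) : StronglyNormalizing r := by
  rintro ⟨s, hs⟩
  exact (acc_iff_isEmpty_descending_chain.1 (h (s 0))).false ⟨s, rfl, hs⟩

/-- Newman's lemma. -/
theorem Confluent.of_locally {α : Type*} {r : α → α → Prop} (hr : ∀ a, Acc (swap r) a)
    (hl : ∀ a b c, r a b → r a c → ∃ d, ReflTransGen r b d ∧ ReflTransGen r c d) :
    Confluent r := by
  intro a
  induction hr a with
  | intro a _ ih =>
    intro b c hb hc
    rcases ReflTransGen.cases_head hb with rfl | ⟨b', hab, hb⟩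
    · exact ⟨c, hc, .refl⟩
    rcases ReflTransGen.cases_head hc with rfl | ⟨c', hac, hc⟩
    · exact ⟨b, .refl, .head hab hb⟩
    obtain ⟨d, hbd, hcd⟩ := hl _ _ _ hab hac
    obtain ⟨e, hbe, hde⟩ := ih b' hab b d hb hbd
    obtain ⟨f, hef, hcf⟩ := ih c' hac e c (hcd.trans hde) hc
    exact ⟨f, hbe.trans hef, hcf⟩

/-! ### Patterns, linearity, typing and overlaps -/

/-- The rank of a symbol. Symbols of rank zero are the constructors; the right-hand sides of the
rules for a symbol contain, apart from the symbol itself, only symbols of smaller rank. -/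
def Sym.rank : Sym → ℕ
  | .tt | .ff | .zero | .succ | .nil _ | .cons _ | .A | .B | .maxS => 0
  | .and | .or | .not | .ite _ => 1
  | .plus | .leN | .eqN | .ltN | .maxN | .zeroL => 1
  | .mem .nat | .add .nat | .del .nat | .eqSet .nat | .leSet .nat => 2
  | .union .nat | .subset .nat | .ltSet .nat => 3
  | .ordS | .leS => 4
  | .sordS | .mem .sub | .add .sub | .del .sub | .eqSet .sub | .leSet .sub => 5
  | .union .sub | .subset .sub | .ltSet .sub | .varL | .succS | .maxAux | .evalS => 6
  | .succL | .maxL => 7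
  | .imaxS | .evalL => 8
  | .imaxAux => 9
  | .imaxL => 10

/-- The position of the argument on which a symbol recurs (irrelevant for symbols whose rules
are not recursive). -/
def Sym.recArg : Sym → ℕ
  | .union _ | .mem _ | .maxL | .imaxAux => 1
  | _ => 0

namespace Term

/-- The variables of a term, with repetitions. -/
def vars : Term → List Var
  | var x => [x]
  | app f ts => (List.finRange f.dom.length).flatMap fun i => (ts i).vars

@[simp]
theorem mem_vars_var {x y : Var} : x ∈ (var y).vars ↔ x = y := by simp [vars]

@[simp]
theorem mem_vars_app {x : Var} {f : Sym} {ts : Fin f.dom.length → Term} :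
    x ∈ (app f ts).vars ↔ ∃ i, x ∈ (ts i).vars := by simp [vars]

/-- A pattern: a term built from variables and constructors. -/
def IsPattern : Term → Prop
  | var _ => True
  | app f ts => f.rank = 0 ∧ ∀ i, (ts i).IsPattern

/-- A left-hand side in a constructor system: a symbol that is not a constructor, applied to
patterns. -/
def IsLhs : Term → Prop
  | var _ => False
  | app f ts => 0 < f.rank ∧ ∀ i, (ts i).IsPattern

/-- No variable occurs twice. -/
def Linear : Term → Prop
  | var _ => True
  | app _ ts => (∀ i, (ts i).Linear) ∧
      ∀ i j, i ≠ j → ∀ x ∈ (ts i).vars, x ∉ (ts j).vars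

/-- Two terms have different symbols at some common position, so that they cannot have a common
instance. -/
def Clash : Term → Term → Prop
  | var _, _ => False
  | app _ _, var _ => False
  | app f ts, app g us => f ≠ g ∨
      ∃ (i : Fin f.dom.length) (j : Fin g.dom.length), i.val = j.val ∧ (ts i).Clash (us j)

/-- Removal of an outer `maxS`. -/
def unmax : Term → Term
  | app .maxS ts => ts ⟨0, by decide⟩
  | t => t

/-- A syntactic criterion for the instances of `t` to be smaller than those of `p`: up to outer
symbols `maxS`, the term `t` is a variable that occurs strictly inside `p`. -/
def IsVarInside (t p : Term) : Prop :=
  match t.unmax, p.unmax with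
  | var x, app g ps => x ∈ (app g ps).vars
  | _, _ => False

/-- In the term, all symbols have smaller rank than `f`, except for calls of `f` in which the
recursion argument is smaller than that of the tuple `ps` of patterns. -/
def CallsBelow (f : Sym) (ps : Fin f.dom.length → Term) : Term → Prop
  | var _ => True
  | app g ts => (∀ i, (ts i).CallsBelow f ps) ∧
      (g.rank < f.rank ∨ g = f ∧ ∃ (i : Fin g.dom.length) (j : Fin f.dom.length),
        i.val = f.recArg ∧ j.val = f.recArg ∧ (ts i).IsVarInside (ps j))

instance decidableWellTyped : DecidablePred WellTyped
  | var _ => isTrue trivial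
  | app f ts =>
    have := fun i => decidableWellTyped (ts i)
    inferInstanceAs (Decidable (∀ i, (ts i).WellTyped ∧ (ts i).sort = f.dom.get i))

instance decidableIsPattern : DecidablePred IsPattern
  | var _ => isTrue trivial
  | app f ts =>
    have := fun i => decidableIsPattern (ts i)
    inferInstanceAs (Decidable (f.rank = 0 ∧ ∀ i, (ts i).IsPattern))

instance : DecidablePred IsLhs
  | var _ => isFalse id
  | app f ts => inferInstanceAs (Decidable (0 < f.rank ∧ ∀ i, (ts i).IsPattern))

instance decidableLinear : DecidablePred Linear
  | var _ => isTrue trivial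
  | app _ ts =>
    have := fun i => decidableLinear (ts i)
    inferInstanceAs (Decidable ((∀ i, (ts i).Linear) ∧
      ∀ i j, i ≠ j → ∀ x ∈ (ts i).vars, x ∉ (ts j).vars))

instance decidableClash : ∀ t u, Decidable (Clash t u)
  | var _, _ => isFalse (by simp [Clash])
  | app _ _, var _ => isFalse id
  | app f ts, app g us =>
    have := fun i j => decidableClash (ts i) (us j)
    inferInstanceAs (Decidable (f ≠ g ∨
      ∃ (i : Fin f.dom.length) (j : Fin g.dom.length), i.val = j.val ∧ (ts i).Clash (us j)))

instance (t p : Term) : Decidable (t.IsVarInside p) := by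
  unfold IsVarInside
  split <;> infer_instance

instance decidableCallsBelow (f : Sym) (ps : Fin f.dom.length → Term) :
    DecidablePred (CallsBelow f ps)
  | var _ => isTrue trivial
  | app g ts =>
    have := fun i => decidableCallsBelow f ps (ts i)
    inferInstanceAs (Decidable ((∀ i, (ts i).CallsBelow f ps) ∧
      (g.rank < f.rank ∨ g = f ∧ ∃ (i : Fin g.dom.length) (j : Fin f.dom.length),
        i.val = f.recArg ∧ j.val = f.recArg ∧ (ts i).IsVarInside (ps j))))

end Term

/-- The conditions on a single rule: the left-hand side is a linear term `f ps` with constructor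
patterns `ps`, the right-hand side has no new variables, makes only calls below `f ps`, and has
the type of the left-hand side. -/
def Rule.Admissible (ρ : Rule) : Prop :=
  ρ.lhs.IsLhs ∧ ρ.lhs.Linear ∧ (∀ x ∈ ρ.rhs.vars, x ∈ ρ.lhs.vars) ∧
    (match ρ.lhs with
      | .var _ => False
      | .app f ps => ρ.rhs.CallsBelow f ps) ∧
    ρ.lhs.WellTyped ∧ ρ.rhs.WellTyped ∧ ρ.rhs.sort = ρ.lhs.sort

instance (ρ : Rule) : Decidable ρ.Admissible := by
  have : Decidable (match ρ.lhs with
      | .var _ => False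
      | .app f ps => ρ.rhs.CallsBelow f ps) := by
    split <;> infer_instance
  unfold Rule.Admissible
  infer_instance

theorem admissible_of_mem_rules : ∀ ρ ∈ rules, ρ.Admissible := by
  decide +kernel

theorem pairwise_clash_rules : rules.Pairwise fun ρ ρ' => ρ.lhs.Clash ρ'.lhs := by
  decide +kernel

/-! ### Reduction in arguments -/

theorem step_iff {R : List Rule} {t u : Term} :
    Step R t u ↔ (∃ ρ ∈ R, ∃ σ, t = ρ.lhs.subst σ ∧ u = ρ.rhs.subst σ) ∨
      ∃ f ts i u', t = .app f ts ∧ Step R (ts i) u' ∧ u = .app f (update ts i u') := by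
  constructor
  · rintro (⟨ρ, hρ, σ⟩ | ⟨f, ts, i, u', h⟩)
    · exact .inl ⟨ρ, hρ, σ, rfl, rfl⟩
    · exact .inr ⟨f, ts, i, u', rfl, h, rfl⟩
  · rintro (⟨ρ, hρ, σ, rfl, rfl⟩ | ⟨f, ts, i, u', rfl, h, rfl⟩)
    · exact .root ρ hρ σ
    · exact .arg f ts i u' h

theorem reflTransGen_step_update {R : List Rule} (f : Sym) (ts : Fin f.dom.length → Term)
    (i : Fin f.dom.length) {u : Term} (h : ReflTransGen (Step R) (ts i) u) :
    ReflTransGen (Step R) (.app f ts) (.app f (update ts i u)) := by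
  induction h with
  | refl => simpa using ReflTransGen.refl
  | tail _ h ih =>
    refine ih.tail ?_
    simpa using Step.arg (R := R) f (update ts i _) i _ (by simpa using h)

theorem reflTransGen_step_app {R : List Rule} (f : Sym) {ts us : Fin f.dom.length → Term}
    (h : ∀ i, ReflTransGen (Step R) (ts i) (us i)) :
    ReflTransGen (Step R) (.app f ts) (.app f us) := by
  suffices H : ∀ s : Finset (Fin f.dom.length),
      ReflTransGen (Step R) (.app f ts) (.app f (s.piecewise us ts)) by
    simpa using H Finset.univ
  intro s
  induction s using Finset.induction_on with
  | empty => simpa using ReflTransGen.refl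
  | insert k s hk ih =>
    rw [Finset.piecewise_insert]
    refine ih.trans (reflTransGen_step_update f _ k ?_)
    simpa [hk] using h k

theorem reflTransGen_step_subst {R : List Rule} {σ τ : Var → Term}
    (h : ∀ x, ReflTransGen (Step R) (σ x) (τ x)) (t : Term) :
    ReflTransGen (Step R) (t.subst σ) (t.subst τ) := by
  induction t with
  | var x => exact h x
  | app f ts ih => exact reflTransGen_step_app f ih

theorem Term.subst_congr {σ τ : Var → Term} {t : Term} (h : ∀ x ∈ t.vars, σ x = τ x) :
    t.subst σ = t.subst τ := by
  induction t with
  | var x => exact h x (by simp)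
  | app f ts ih =>
    simp only [Term.subst, Term.app.injEq, heq_eq_eq, true_and]
    exact funext fun i => ih i fun x hx => h x (Term.mem_vars_app.2 ⟨i, hx⟩)

/-! ### Confluence -/

/-- Admissible rules without overlaps: the left-hand sides of rules at different places in the
list have no common instance. Such a system is orthogonal. -/
structure AdmissibleSystem (R : List Rule) : Prop where
  admissible : ∀ ρ ∈ R, ρ.Admissible
  pairwise : R.Pairwise fun ρ ρ' => ρ.lhs.Clash ρ'.lhs

theorem Term.Clash.subst_ne {t u : Term} (h : t.Clash u) (σ τ : Var → Term) :
    t.subst σ ≠ u.subst τ := by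
  induction t generalizing u with
  | var x => simp [Clash] at h
  | app f ts ih =>
    cases u with
    | var y => exact h.elim
    | app g us =>
      intro he
      simp only [Term.subst, Term.app.injEq] at he
      obtain ⟨rfl, he⟩ := he
      rcases h with h | ⟨i, j, hij, h⟩
      · exact h rfl
      · obtain rfl := Fin.ext hij
        exact ih i h (congrFun (eq_of_heq he) i)

/-- A term matches a pattern in at most one way. -/
theorem Term.eq_of_subst_eq {σ τ : Var → Term} {t : Term} (h : t.subst σ = t.subst τ) :
    ∀ x ∈ t.vars, σ x = τ x := by
  induction t with
  | var x => simpa [Term.subst] using h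
  | app f ts ih =>
    intro x hx
    obtain ⟨i, hi⟩ := Term.mem_vars_app.1 hx
    simp only [Term.subst, Term.app.injEq, heq_eq_eq, true_and] at h
    exact ih i (congrFun h i) x hi

/-- At the root, reduction is deterministic. -/
theorem AdmissibleSystem.rhs_eq {R : List Rule} (hR : AdmissibleSystem R) {ρ ρ' : Rule} (hρ : ρ ∈ R)
    (hρ' : ρ' ∈ R) {σ τ : Var → Term} (h : ρ.lhs.subst σ = ρ'.lhs.subst τ) :
    ρ.rhs.subst σ = ρ'.rhs.subst τ := by
  let S : Rule → Rule → Prop := fun ρ ρ' =>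
    ∀ σ τ, ρ.lhs.subst σ = ρ'.lhs.subst τ → ρ.rhs.subst σ = ρ'.rhs.subst τ
  have : Std.Symm S := ⟨fun ρ ρ' h σ τ he => (h τ σ he.symm).symm⟩
  refine List.Pairwise.forall_of_forall (R := S) (fun ρ hρ σ τ he => ?_)
    (hR.pairwise.imp fun hc σ τ he => (hc.subst_ne σ τ he).elim) hρ hρ' σ τ h
  exact Term.subst_congr fun x hx =>
    Term.eq_of_subst_eq he x ((hR.admissible ρ hρ).2.2.1 x hx)

/-- No rule applies at the root of a constructor. -/
theorem AdmissibleSystem.rank_pos {R : List Rule} (hR : AdmissibleSystem R) {ρ : Rule} (hρ : ρ ∈ R)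
    {σ : Var → Term} {f : Sym} {ts : Fin f.dom.length → Term}
    (h : Term.app f ts = ρ.lhs.subst σ) : 0 < f.rank := by
  have hl := (hR.admissible ρ hρ).1
  cases hρl : ρ.lhs with
  | var x => simp [hρl, Term.IsLhs] at hl
  | app g us =>
    rw [hρl] at h hl
    simp only [Term.subst, Term.app.injEq] at h
    obtain ⟨rfl, -⟩ := h
    exact hl.1

theorem AdmissibleSystem.not_step_var {R : List Rule} (hR : AdmissibleSystem R) {x : Var} {t : Term} :
    ¬ Step R (.var x) t := by
  intro h
  rcases step_iff.1 h with ⟨ρ, hρ, σ, he, -⟩ | ⟨f, ts, i, u, he, -⟩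
  · have hl := (hR.admissible ρ hρ).1
    cases hρl : ρ.lhs with
    | var y => simp [hρl, Term.IsLhs] at hl
    | app g us => simp [hρl, Term.subst] at he
  · simp at he

/-- If a reduction in the `i`-th argument of an instance of `f ps` is obtained by reducing the
value of a variable `x` of `ps i`, then so is the reduction of the whole instance, since by
linearity `x` does not occur in the other arguments. -/
theorem subst_update_args {R : List Rule} {f : Sym} {ps : Fin f.dom.length → Term}
    (hlin : (Term.app f ps).Linear) {σ : Var → Term} {i : Fin f.dom.length} {u : Term}
    (h : ∃ x ∈ (ps i).vars, ∃ t, Step R (σ x) t ∧ u = (ps i).subst (update σ x t)) :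
    ∃ x ∈ (Term.app f ps).vars, ∃ t, Step R (σ x) t ∧
      Term.app f (update (fun j => (ps j).subst σ) i u) =
        (Term.app f ps).subst (update σ x t) := by
  obtain ⟨x, hx, t, ht, rfl⟩ := h
  refine ⟨x, Term.mem_vars_app.2 ⟨i, hx⟩, t, ht, ?_⟩
  simp only [Term.subst, Term.app.injEq, heq_eq_eq, true_and]
  funext j
  rcases eq_or_ne j i with rfl | hj
  · simp
  · rw [update_of_ne hj]
    refine Term.subst_congr fun y hy => ?_
    have : y ≠ x := by
      rintro rfl
      exact hlin.2 j i hj y hy hx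
    rw [update_of_ne this]

/-- Every reduct of an instance of a linear pattern is obtained by reducing the value of a
variable. -/
theorem Step.of_pattern {R : List Rule} (hR : AdmissibleSystem R) {p : Term} (hp : p.IsPattern)
    (hlin : p.Linear) {σ : Var → Term} {u : Term} (h : Step R (p.subst σ) u) :
    ∃ x ∈ p.vars, ∃ t, Step R (σ x) t ∧ u = p.subst (update σ x t) := by
  induction p generalizing u with
  | var x => exact ⟨x, by simp, u, h, by simp [Term.subst]⟩
  | app f ps ih =>
    rcases step_iff.1 h with ⟨ρ, hρ, τ, he, -⟩ | ⟨g, ts, i, u', he, hu, rfl⟩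
    · exact absurd hp.1 (hR.rank_pos hρ he).ne'
    · simp only [Term.subst, Term.app.injEq] at he
      obtain ⟨rfl, he⟩ := he
      obtain rfl := eq_of_heq he
      exact subst_update_args hlin (ih i (hp.2 i) (hlin.1 i) hu)

/-- A reduction at the root and one in an argument can be joined. -/
theorem Step.join_root_arg {R : List Rule} (hR : AdmissibleSystem R) {ρ : Rule} (hρ : ρ ∈ R)
    {σ : Var → Term} {f : Sym} {ts : Fin f.dom.length → Term} {i : Fin f.dom.length} {u : Term}
    (he : Term.app f ts = ρ.lhs.subst σ) (hu : Step R (ts i) u) :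
    ∃ d, ReflTransGen (Step R) (ρ.rhs.subst σ) d ∧
      ReflTransGen (Step R) (.app f (update ts i u)) d := by
  obtain ⟨hl, hlin, -⟩ := hR.admissible ρ hρ
  suffices h : ∃ x ∈ ρ.lhs.vars, ∃ t, Step R (σ x) t ∧
      Term.app f (update ts i u) = ρ.lhs.subst (update σ x t) by
    obtain ⟨x, -, t, ht, h⟩ := h
    refine ⟨ρ.rhs.subst (update σ x t), reflTransGen_step_subst (fun y => ?_) _,
      .single (h ▸ .root ρ hρ _)⟩
    rcases eq_or_ne y x with rfl | hy
    · simpa using ReflTransGen.single ht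
    · simpa [hy] using ReflTransGen.refl
  cases hρl : ρ.lhs with
  | var x => simp [hρl, Term.IsLhs] at hl
  | app g ps =>
    rw [hρl] at he hl hlin
    simp only [Term.subst, Term.app.injEq] at he
    obtain ⟨rfl, he⟩ := he
    obtain rfl := eq_of_heq he
    exact subst_update_args hlin (Step.of_pattern hR (hl.2 i) (hlin.1 i) hu)

theorem AdmissibleSystem.locally_confluent {R : List Rule} (hR : AdmissibleSystem R) (a b c : Term)
    (hb : Step R a b) (hc : Step R a c) :
    ∃ d, ReflTransGen (Step R) b d ∧ ReflTransGen (Step R) c d := by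
  induction a generalizing b c with
  | var x => exact (hR.not_step_var hb).elim
  | app f ts ih =>
    rcases step_iff.1 hb with ⟨ρ, hρ, σ, he, rfl⟩ | ⟨g, ts', i, u, he, hu, rfl⟩
    · rcases step_iff.1 hc with ⟨ρ', hρ', τ, he', rfl⟩ | ⟨g, ts', i, u, he', hu, rfl⟩
      · exact ⟨_, .refl, hR.rhs_eq hρ hρ' (he ▸ he') ▸ .refl⟩
      · exact Step.join_root_arg hR hρ (he' ▸ he) hu
    · simp only [Term.app.injEq] at he
      obtain ⟨rfl, he⟩ := he
      obtain rfl := eq_of_heq he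
      rcases step_iff.1 hc with ⟨ρ', hρ', τ, he', rfl⟩ | ⟨g, ts', j, w, he', hw, rfl⟩
      · obtain ⟨d, h₁, h₂⟩ := Step.join_root_arg hR hρ' he' hu
        exact ⟨d, h₂, h₁⟩
      · simp only [Term.app.injEq] at he'
        obtain ⟨rfl, he'⟩ := he'
        obtain rfl := eq_of_heq he'
        rcases eq_or_ne i j with rfl | hij
        · obtain ⟨d, h₁, h₂⟩ := ih i u w hu hw
          refine ⟨.app f (update ts i d), ?_, ?_⟩
          · simpa using reflTransGen_step_update f (update ts i u) i (by simpa using h₁)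
          · simpa using reflTransGen_step_update f (update ts i w) i (by simpa using h₂)
        · refine ⟨.app f (update (update ts i u) j w), .single (.arg _ _ _ _ ?_), ?_⟩
          · simpa [hij.symm] using hw
          · rw [update_comm hij]
            exact .single (.arg _ _ _ _ (by simpa [hij] using hu))

/-! ### Strong normalization -/

/-- A term is strongly normalizing if it is accessible for reduction. -/
abbrev SN (R : List Rule) (t : Term) : Prop := Acc (swap (Step R)) t

/-- The relation with which recursion arguments are compared: `s` is a one-step reduct or an
immediate subterm of `t`. -/
def Below (R : List Rule) (s t : Term) : Prop :=
  Step R t s ∨ ∃ f ts i, t = .app f ts ∧ s = ts i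

theorem Below.arg (R : List Rule) {f : Sym} (ts : Fin f.dom.length → Term)
    (i : Fin f.dom.length) : Below R (ts i) (.app f ts) := .inr ⟨f, ts, i, rfl, rfl⟩

/-- Immediate subterms do no harm to accessibility: a reduction in a subterm is a reduction of
the whole term. -/
theorem SN.acc_below {R : List Rule} {t : Term} (ht : SN R t) : Acc (Below R) t := by
  induction ht with
  | intro t _ ih =>
    -- The subterms of `t` are reached by structural induction, keeping the property that all
    -- their reducts are accessible.
    have ih : ∀ u, Step R t u → Acc (Below R) u := ih
    clear * - ih
    induction t with
    | var x =>
      refine ⟨_, fun y hy => ?_⟩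
      rcases hy with hy | ⟨f, ts, i, he, -⟩
      · exact ih y hy
      · simp at he
    | app f ts iht =>
      refine ⟨_, fun y hy => ?_⟩
      rcases hy with hy | ⟨g, ts', i, he, rfl⟩
      · exact ih y hy
      · simp only [Term.app.injEq] at he
        obtain ⟨rfl, he⟩ := he
        obtain rfl := eq_of_heq he
        refine iht i fun u hu => (ih _ (.arg f ts i u hu)).inv ?_
        simpa using Below.arg R (update ts i u) i

theorem sn_of_acc_below {R : List Rule} {t : Term} (ht : Acc (Below R) t) : SN R t :=
  Subrelation.accessible (fun h => Or.inl h) ht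

theorem SN.of_app {R : List Rule} {f : Sym} {ts : Fin f.dom.length → Term}
    (h : SN R (.app f ts)) (i : Fin f.dom.length) : SN R (ts i) :=
  sn_of_acc_below (h.acc_below.inv (Below.arg R ts i))

theorem SN.of_subst {R : List Rule} {t : Term} {σ : Var → Term} (h : SN R (t.subst σ)) :
    ∀ x ∈ t.vars, SN R (σ x) := by
  induction t with
  | var x => simpa [Term.subst] using h
  | app f ts ih =>
    intro x hx
    obtain ⟨i, hi⟩ := Term.mem_vars_app.1 hx
    exact ih i (h.of_app i) x hi

theorem Term.unmax_eq_or (t : Term) :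
    t.unmax = t ∨ ∃ ts : Fin Sym.maxS.dom.length → Term,
      t = .app .maxS ts ∧ t.unmax = ts ⟨0, by decide⟩ := by
  unfold unmax
  split
  · exact .inr ⟨_, rfl, rfl⟩
  · exact .inl rfl

theorem Term.unmax_below (R : List Rule) (t : Term) : ReflTransGen (Below R) t.unmax t := by
  rcases t.unmax_eq_or with h | ⟨ts, rfl, h⟩
  · rw [h]
  · exact h ▸ .single (Below.arg R ts _)

theorem Term.vars_below_subst (R : List Rule) {t : Term} {x : Var} (hx : x ∈ t.vars)
    (σ : Var → Term) : ReflTransGen (Below R) (σ x) (t.subst σ) := by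
  induction t with
  | var y =>
    obtain rfl := mem_vars_var.1 hx
    exact .refl
  | app f ts ih =>
    obtain ⟨i, hi⟩ := mem_vars_app.1 hx
    exact (ih i hi).tail (Below.arg R (fun i => (ts i).subst σ) i)

theorem Term.unmax_subst_app (f : Sym) (ts : Fin f.dom.length → Term) (σ : Var → Term) :
    ((app f ts).subst σ).unmax = (app f ts).unmax.subst σ := by
  cases f <;> rfl

/-- A recursive call in a right-hand side decreases the recursion argument, up to an outer
`maxS`, under every substitution, also one that puts a term `maxS E` in place of a variable. -/
theorem Term.IsVarInside.transGen {R : List Rule} {t p : Term} (h : t.IsVarInside p)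
    (σ : Var → Term) : TransGen (Below R) (t.subst σ).unmax (p.subst σ).unmax := by
  unfold IsVarInside at h
  split at h
  case h_2 => exact h.elim
  case h_1 x g ps ht hp =>
  have h₁ : ReflTransGen (Below R) (t.subst σ).unmax (σ x) := by
    rcases t.unmax_eq_or with h | ⟨ts, rfl, h⟩
    · obtain rfl := h.symm.trans ht
      exact unmax_below R _
    · rw [h] at ht
      simp only [subst, unmax, ht]
      exact .refl
  have h₂ : (p.subst σ).unmax = (app g ps).subst σ := by
    cases p with
    | var y => simp [unmax] at hp
    | app f qs => rw [unmax_subst_app, hp]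
  rw [h₂]
  obtain ⟨i, hi⟩ := mem_vars_app.1 h
  exact (TransGen.single (Below.arg R (fun i => (ps i).subst σ) i)).trans_right
    (h₁.trans (vars_below_subst R hi σ))

/-- Reduction decreases recursion arguments. For a term `maxS E` this uses that `maxS` is a
constructor. -/
theorem AdmissibleSystem.unmax_transGen {R : List Rule} (hR : AdmissibleSystem R) {t u : Term}
    (h : Step R t u) : TransGen (Below R) u.unmax t.unmax := by
  rcases t.unmax_eq_or with ht | ⟨ts, rfl, ht⟩
  · rw [ht]
    exact (TransGen.single (.inl h)).trans_right (Term.unmax_below R u)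
  · rcases step_iff.1 h with ⟨ρ, hρ, σ, he, -⟩ | ⟨g, ts', i, u', he, hu, rfl⟩
    · exact absurd (hR.rank_pos hρ he) (by decide)
    · simp only [Term.app.injEq] at he
      obtain ⟨rfl, he⟩ := he
      obtain rfl := eq_of_heq he
      obtain rfl : i = ⟨0, by decide⟩ := Fin.ext (by have := i.2; simp [Sym.dom] at this; omega)
      refine .single (.inl ?_)
      simpa [Term.unmax] using hu

/-- The recursion argument of `f us` is smaller than the one of `f ts`. -/
def RecBelow (R : List Rule) (f : Sym) (us ts : Fin f.dom.length → Term) : Prop :=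
  ∃ j, j.val = f.recArg ∧ TransGen (Below R) (us j).unmax (ts j).unmax

theorem acc_recBelow {R : List Rule} {f : Sym} {ts : Fin f.dom.length → Term}
    (h : ∀ i, SN R (ts i)) : Acc (RecBelow R f) ts := by
  by_cases hf : f.recArg < f.dom.length
  · have hacc : Acc (Below R) (ts ⟨_, hf⟩).unmax := by
      have := (h ⟨_, hf⟩).acc_below
      rcases (ts ⟨_, hf⟩).unmax_eq_or with h | ⟨us, h, h'⟩
      · rwa [h]
      · rw [h']
        rw [h] at this
        exact this.inv (Below.arg R us _)
    refine Subrelation.accessible ?_ (InvImage.accessible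
      (fun us : Fin f.dom.length → Term => (us ⟨_, hf⟩).unmax) hacc.transGen)
    rintro us ts ⟨j, hj, hlt⟩
    obtain rfl : j = ⟨_, hf⟩ := Fin.ext hj
    exact hlt
  · exact ⟨_, fun us ⟨j, hj, _⟩ => (hf (hj ▸ j.2)).elim⟩

/-- The instance of a right-hand side is strongly normalizing if the values of its variables
are and if all calls in it preserve strong normalization. -/
theorem Term.CallsBelow.sn {R : List Rule} {f : Sym} {ps : Fin f.dom.length → Term}
    {σ : Var → Term}
    (hrank : ∀ g : Sym, g.rank < f.rank → ∀ us, (∀ i, SN R (us i)) → SN R (.app g us))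
    (hrec : ∀ us, RecBelow R f us (fun i => (ps i).subst σ) → (∀ i, SN R (us i)) →
      SN R (.app f us))
    {t : Term} (ht : t.CallsBelow f ps) (hσ : ∀ x ∈ t.vars, SN R (σ x)) :
    SN R (t.subst σ) := by
  induction t with
  | var x => exact hσ x (by simp)
  | app g ts ih =>
    have hts : ∀ i, SN R ((ts i).subst σ) := fun i =>
      ih i (ht.1 i) fun x hx => hσ x (mem_vars_app.2 ⟨i, hx⟩)
    rcases ht.2 with h | ⟨rfl, i, j, hi, hj, h⟩
    · exact hrank g h _ hts
    · obtain rfl : i = j := Fin.ext (hi.trans hj.symm)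
      exact hrec _ ⟨i, hi, h.transGen σ⟩ hts

/-- A symbol applied to strongly normalizing terms is strongly normalizing. -/
theorem SN.app {R : List Rule} (hR : AdmissibleSystem R) (f : Sym) (ts : Fin f.dom.length → Term)
    (h : ∀ i, SN R (ts i)) : SN R (.app f ts) := by
  induction hn : f.rank using Nat.strong_induction_on generalizing f with
  | _ n ihrank =>
  subst hn
  induction acc_recBelow h with
  | intro ts hacc ihrec =>
    -- The hypothesis on smaller recursion arguments is kept while the arguments are reduced.
    induction acc_update h with
    | intro ts _ ihargs =>
      refine ⟨_, fun y (hy : Step R _ y) => ?_⟩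
      rcases step_iff.1 hy with ⟨ρ, hρ, σ, he, rfl⟩ | ⟨g, ts', i, u, he, hu, rfl⟩
      · obtain ⟨hl, -, hvars, hcalls, -⟩ := hR.admissible ρ hρ
        cases hρl : ρ.lhs with
        | var x => simp [hρl, Term.IsLhs] at hl
        | app g ps =>
          simp only [hρl] at he hcalls hvars
          simp only [Term.subst, Term.app.injEq] at he
          obtain ⟨rfl, he⟩ := he
          obtain rfl := eq_of_heq he
          refine hcalls.sn (fun g hg us hus => ihrank _ hg g us hus rfl)
            (fun us hus hs => ihrec us hus hs) fun x hx => ?_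
          obtain ⟨i, hi⟩ := Term.mem_vars_app.1 (hvars x hx)
          exact (h i).of_subst x hi
      · simp only [Term.app.injEq] at he
        obtain ⟨rfl, he⟩ := he
        obtain rfl := eq_of_heq he
        have mono : ∀ us, RecBelow R f us (update ts i u) → RecBelow R f us ts := by
          rintro us ⟨j, hj, hlt⟩
          refine ⟨j, hj, ?_⟩
          rcases eq_or_ne j i with rfl | hji
          · exact hlt.trans (by simpa using hR.unmax_transGen hu)
          · simpa [hji] using hlt
        exact ihargs _ ⟨i, u, hu, rfl⟩ (fun us hus => hacc us (mono us hus))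
          (fun us hus => ihrec us (mono us hus)) (acc_update_apply h hu)

theorem AdmissibleSystem.sn {R : List Rule} (hR : AdmissibleSystem R) (t : Term) : SN R t := by
  induction t with
  | var x => exact ⟨_, fun y hy => (hR.not_step_var hy).elim⟩
  | app f ts ih => exact SN.app hR f ts ih

/-! ### Typing -/

theorem Term.WellTyped.subst {σ : Var → Term} {t : Term} (ht : t.WellTyped)
    (hσ : ∀ x ∈ t.vars, (σ x).WellTyped ∧ (σ x).sort = x.sort) :
    (t.subst σ).WellTyped ∧ (t.subst σ).sort = t.sort := by
  induction t with
  | var x => exact hσ x (by simp)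
  | app f ts ih =>
    refine ⟨fun i => ?_, rfl⟩
    obtain ⟨h₁, h₂⟩ := ih i (ht i).1 fun x hx => hσ x (mem_vars_app.2 ⟨i, hx⟩)
    exact ⟨h₁, h₂.trans (ht i).2⟩

theorem Term.WellTyped.of_subst {σ : Var → Term} {t : Term} (ht : t.WellTyped)
    (h : (t.subst σ).WellTyped) (hs : (t.subst σ).sort = t.sort) :
    ∀ x ∈ t.vars, (σ x).WellTyped ∧ (σ x).sort = x.sort := by
  induction t with
  | var x =>
    intro y hy
    obtain rfl := mem_vars_var.1 hy
    exact ⟨h, hs⟩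
  | app f ts ih =>
    intro x hx
    obtain ⟨i, hi⟩ := mem_vars_app.1 hx
    exact ih i (ht i).1 (h i).1 ((h i).2.trans (ht i).2.symm) x hi

/-- Subject reduction. -/
theorem Step.wellTyped {R : List Rule} (hR : AdmissibleSystem R) {t u : Term} (h : Step R t u)
    (ht : t.WellTyped) : u.WellTyped ∧ u.sort = t.sort := by
  induction h with
  | root ρ hρ σ =>
    obtain ⟨hl, -, hvars, -, htl, htr, hs⟩ := hR.admissible ρ hρ
    have hsort : (ρ.lhs.subst σ).sort = ρ.lhs.sort := by
      cases hρl : ρ.lhs with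
      | var x => simp [hρl, Term.IsLhs] at hl
      | app g us => rfl
    obtain ⟨h₁, h₂⟩ := htr.subst fun x hx => htl.of_subst ht hsort x (hvars x hx)
    exact ⟨h₁, h₂.trans (hs.trans hsort.symm)⟩
  | arg f ts i u _ ih =>
    obtain ⟨h₁, h₂⟩ := ih (ht i).1
    refine ⟨fun j => ?_, rfl⟩
    rcases eq_or_ne j i with rfl | hj
    · simpa using ⟨h₁, h₂.trans (ht j).2⟩
    · simpa [hj] using ht j

theorem exists_typed_of_reflTransGen {R : List Rule} (hR : AdmissibleSystem R)
    (a : {t : Term // t.WellTyped}) {d : Term} (h : ReflTransGen (Step R) a.1 d) :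
    ∃ hd : d.WellTyped, ReflTransGen (TypedStep R) a ⟨d, hd⟩ := by
  induction h with
  | refl => exact ⟨a.2, .refl⟩
  | tail _ h ih =>
    obtain ⟨hb, ih⟩ := ih
    exact ⟨(h.wellTyped hR hb).1, ih.tail h⟩

theorem Confluent.typed {R : List Rule} (hR : AdmissibleSystem R) (h : Confluent (Step R)) :
    Confluent (TypedStep R) := by
  intro a b c hb hc
  have forget : ∀ {x y : {t : Term // t.WellTyped}}, ReflTransGen (TypedStep R) x y →
      ReflTransGen (Step R) x.1 y.1 := fun h => h.lift Subtype.val fun _ _ h => h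
  obtain ⟨d, hbd, hcd⟩ := h a.1 b.1 c.1 (forget hb) (forget hc)
  obtain ⟨hd, hbd⟩ := exists_typed_of_reflTransGen hR b hbd
  obtain ⟨_, hcd⟩ := exists_typed_of_reflTransGen hR c hcd
  exact ⟨⟨d, hd⟩, hbd, hcd⟩

theorem StronglyNormalizing.typed {R : List Rule} (h : StronglyNormalizing (Step R)) :
    StronglyNormalizing (TypedStep R) :=
  fun ⟨s, hs⟩ => h ⟨fun n => (s n).1, hs⟩

theorem admissibleSystem_rules : AdmissibleSystem rules :=
  ⟨admissible_of_mem_rules, pairwise_clash_rules⟩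

end LevelRewriting

/-- The rewrite system implementing universe levels is confluent and strongly normalizing, both
on well-typed terms and on all first-order terms over its signature. -/
theorem mainTheorem8 :
    (LevelRewriting.Confluent (LevelRewriting.TypedStep LevelRewriting.rules) ∧
      LevelRewriting.StronglyNormalizing (LevelRewriting.TypedStep LevelRewriting.rules)) ∧
    (LevelRewriting.Confluent (LevelRewriting.Step LevelRewriting.rules) ∧
      LevelRewriting.StronglyNormalizing (LevelRewriting.Step LevelRewriting.rules)) := by
  have hR := LevelRewriting.admissibleSystem_rules
  have hc := LevelRewriting.Confluent.of_locally hR.sn hR.locally_confluent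
  have hn := LevelRewriting.stronglyNormalizing_of_acc hR.sn
  exact ⟨⟨hc.typed hR, hn.typed⟩, hc, hn⟩
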